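/- **The cooperative network creation game.** Let $G=(V,E)$ be a host graph with $|V|=n$, one player per vertex, and let $\alpha\ge 0$ be the link cost. A joint strategy $s$ assigns to each player $i$ and each edge $e\in E$ an amount $s(i,e)\ge 0$. The created network is $G_s=(V,E_s)$ with $E_s=\{e\in E:\sum_{i}s(i,e)\ge\alpha\}$. For $e\in E_s$ let $s'(i,e)=\alpha\, s(i,e)/\sum_k s(k,e)$ if $\sum_k s(k,e)>\alpha$, and $s'(i,e)=s(i,e)$ otherwise. Player $i$ has cost $c_i(s)=\sum_{e\in E_s}s'(i,e)+\sum_{j\in V}d_{G_s}(i,j)$, and the total cost is $c(s)=\alpha|E_s|+\sum_{i,j\in V}d_{G_s}(i,j)$, where $d_{G_s}$ is the graph distance ($\infty$ between different components). A joint strategy $s$ is a *collaborative equilibrium* if $G_s$ is connected (so that all costs are finite) and, for every edge $e$ of $G$, every nonempty coalition $C\subseteq V$ and every joint strategy $t$ that differs from $s$ only in the amounts offered for $e$ by members of $C$, some $i\in C$ has $c_i(t)\ge c_i(s)$ (no coalition can make all its members strictly better off by changing its offers for one edge). Then $G_s$ is called an *equilibrium graph*. The *price of anarchy* is the maximum of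 $c(s)$ over all collaborative equilibria divided by the minimum of $c(s)$ over all joint strategies. **Theorem.** There is an absolute constant $K>0$ such that for every $n$ and every real $\alpha>n$, in the cooperative network creation game whose host graph is the complete graph on $n$ vertices, the price of anarchy is at most $$K\Bigl(1+\sqrt{n/\alpha}\;\lg^{1+\lg 6}n\Bigr),$$ and every equilibrium graph has diameter at most $$K\,\lg^{\lg 6}n\cdot\sqrt{\alpha/n}.$$ Here $\lg$ is the logarithm to base $2$ (for $n\le 1$ the quotient $0/0$ is read as $0$). -/

import Mathlib

open scoped NNReal ENNReal

/-- Joint strategies of the cooperative network creation game on the host graph `G`: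
`s i e` is the amount player `i` is willing to pay for the edge `e` of `G`. -/
abbrev JointStrategy {V : Type*} (G : SimpleGraph V) : Type _ :=
  V → G.edgeSet → ℝ≥0

namespace JointStrategy

variable {V : Type*} [Fintype V] {G : SimpleGraph V}

/-- The total amount offered for the edge `e`. -/
def offered (s : JointStrategy G) (e : G.edgeSet) : ℝ≥0 :=
  ∑ i, s i e

/-- The set `E_s` of created edges: those for which at least `α` is offered. -/
def builtEdges (α : ℝ≥0) (s : JointStrategy G) : Set G.edgeSet :=
  {e | α ≤ s.offered e}

/-- The created network `G_s`, a spanning subgraph of the host graph. -/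
def graph (α : ℝ≥0) (s : JointStrategy G) : SimpleGraph V :=
  SimpleGraph.fromEdgeSet (Subtype.val '' builtEdges α s)

/-- The share `s'(i, e)` that player `i` pays for a created edge `e`: the offers are scaled down
uniformly to have sum `α` when they exceed `α`. -/
noncomputable def payment (α : ℝ≥0) (s : JointStrategy G) (i : V) (e : G.edgeSet) : ℝ≥0 :=
  if α < s.offered e then α * s i e / s.offered e else s i e

open Classical in
/-- The cost `c_i(s)` of player `i`: payments for created edges plus the sum of the distances to
all players in `G_s` (the distance is `∞` between vertices that are not connected). -/
noncomputable def playerCost (α : ℝ≥0) (s : JointStrategy G) (i : V) : ℝ≥0∞ :=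
  ((∑ e with e ∈ builtEdges α s, payment α s i e : ℝ≥0) : ℝ≥0∞)
    + ∑ j, ((s.graph α).edist i j : ℝ≥0∞)

/-- The total cost `c(s) = α |E_s| + ∑ i, ∑ j, d(i, j)`. -/
noncomputable def totalCost (α : ℝ≥0) (s : JointStrategy G) : ℝ≥0∞ :=
  (α : ℝ≥0∞) * ((builtEdges α s).ncard : ℝ≥0∞)
    + ∑ i, ∑ j, ((s.graph α).edist i j : ℝ≥0∞)

/-- `s'` differs from `s` only in what the members of the coalition `C` offer for the edge `e`. -/
def IsDeviation (C : Set V) (e : G.edgeSet) (s s' : JointStrategy G) : Prop :=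
  ∀ i f, s' i f ≠ s i f → i ∈ C ∧ f = e

/-- `s` is a collaborative equilibrium: `G_s` is connected (all costs are finite), and no
coalition can change its offers for a single edge so that all its members become better off. -/
def IsCollaborativeEquilibrium (α : ℝ≥0) (s : JointStrategy G) : Prop :=
  (s.graph α).Connected ∧
    ∀ (e : G.edgeSet) (C : Set V), C.Nonempty →
      ∀ s' : JointStrategy G, IsDeviation C e s s' →
        ∃ i ∈ C, playerCost α s i ≤ playerCost α s' i

end JointStrategy

/-- The price of anarchy: the largest total cost of a collaborative equilibrium divided by the
least total cost of a joint strategy. -/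
noncomputable def priceOfAnarchy {V : Type*} [Fintype V] (G : SimpleGraph V) (α : ℝ≥0) : ℝ≥0∞ :=
  (⨆ (s : JointStrategy G) (_ : s.IsCollaborativeEquilibrium α), s.totalCost α) /
    ⨅ s : JointStrategy G, s.totalCost α

/-! Two kinds of deviation carry the proof. If a new edge `uv` shortened every pair in `X × W` by
`g`, the members of `X` could split its price evenly, so an equilibrium has `|X| |W| g ≤ α`
(`shortcutBound`). If deleting a built edge raised the distances by less than `α` in total, some
player would pay more for it than that player's own loss and would withdraw (`deletionBound`).

Shortcuts control the diameter. Let all balls of radius `k` have at least `Y` vertices, and let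
`B(u, 5k)` contain at most half of the `n` vertices. Each point of a net on the sphere of radius
`5k` can serve at most `2α / (Yk)` of the outer vertices, so the net is large, and disjoint
`k`-balls around it give `|B(u, 6k)| ≥ Y · (Ykn / 4α)`. The factor in parentheses at least squares
whenever the radius grows sixfold. Starting from `k ≈ √(α/n)`, about `lg lg n` rounds produce a ball
with more than half of the vertices, and a last shortcut puts every vertex close to its centre.

For the edges, one on a cycle of length `O(lg n)` has a short detour. Charging the detours to fixed
geodesics gives `α · #(such edges) ≤ O(lg n) · ∑ d(i, j)`. The other edges form a graph of
logarithmic girth, with at most `2n` edges. Dividing by `α (n - 1)`, a lower bound for the cost of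
any network, gives the price of anarchy. -/

namespace SimpleGraph

/-! ### Ball growth and the diameter -/

variable {V : Type*} {G : SimpleGraph V}

/-- On a geodesic from `u` to `w` there is a vertex at every distance up to `G.dist u w`. -/
theorem Connected.exists_dist_eq_add (hG : G.Connected) (u w : V) {k : ℕ} (hk : k ≤ G.dist u w) :
    ∃ x, G.dist u x = k ∧ G.dist u w = k + G.dist x w := by
  obtain ⟨p, hp⟩ := hG.exists_walk_length_eq_dist u w
  have h1 := dist_le (p.take k)
  have h2 := dist_le (p.drop k)
  have h3 := hG.dist_triangle (u := u) (v := p.getVert k) (w := w)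
  rw [Walk.take_length] at h1
  rw [Walk.drop_length] at h2
  exact ⟨p.getVert k, by omega, by omega⟩

variable [Fintype V]

open Classical in
/-- The set of vertices at distance at most `r` from `u`, as a finset. -/
noncomputable def distBall (G : SimpleGraph V) (u : V) (r : ℕ) : Finset V :=
  {w | G.dist u w ≤ r}

@[simp]
theorem mem_distBall {u w : V} {r : ℕ} : w ∈ G.distBall u r ↔ G.dist u w ≤ r := by
  simp [distBall]

theorem distBall_mono (u : V) {r r' : ℕ} (h : r ≤ r') : G.distBall u r ⊆ G.distBall u r' :=
  fun w hw => by rw [mem_distBall] at *; omega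

/-- A geodesic from `u` to `w` meets each of the distances `0, …, r`. -/
theorem Connected.succ_le_card_distBall (hG : G.Connected) {u w : V} {r : ℕ}
    (h : r < G.dist u w) : r + 1 ≤ (G.distBall u r).card := by
  classical
  have := hG.nonempty
  choose! f hf using fun k (hk : k ≤ G.dist u w) => hG.exists_dist_eq_add u w hk
  have := Finset.card_le_card_of_injOn (s := Finset.range (r + 1)) (t := G.distBall u r) f
    (fun k hk => by
      have hk : k < r + 1 := by simpa using hk
      simpa [(hf k (by omega)).1] using Nat.lt_succ_iff.mp hk)
    (fun k hk l hl hkl => by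
      have hk : k < r + 1 := by simpa using hk
      have hl : l < r + 1 := by simpa using hl
      rw [← (hf k (by omega)).1, ← (hf l (by omega)).1, hkl])
  simpa using this

theorem Connected.distBall_eq_univ_or (hG : G.Connected) (u : V) (r : ℕ) :
    G.distBall u r = Finset.univ ∨ r + 1 ≤ (G.distBall u r).card := by
  by_cases h : ∃ w, r < G.dist u w
  · obtain ⟨w, hw⟩ := h
    exact Or.inr (hG.succ_le_card_distBall hw)
  · push Not at h
    exact Or.inl (by ext; simp [h])

/-- No additional edge `uv` decreases the distances by more than `α` in total: if a path through
`uv` would be shorter by `g` for all pairs in `X × W`, then `|X| |W| g ≤ α`. -/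
def ShortcutBound (G : SimpleGraph V) (α : ℝ) : Prop :=
  ∀ (X W : Finset V) (u v : V) (g : ℕ),
    (∀ x ∈ X, ∀ w ∈ W, G.dist x u + 1 + G.dist v w + g ≤ G.dist x w) →
      (X.card : ℝ) * W.card * g ≤ α

/-- A maximal set of vertices of `S` at pairwise distances more than `r`. -/
theorem exists_separated_net (G : SimpleGraph V) (S : Finset V) (r : ℕ) :
    ∃ T ⊆ S, (∀ s ∈ T, ∀ t ∈ T, s ≠ t → r < G.dist s t) ∧
      ∀ x ∈ S, ∃ t ∈ T, G.dist t x ≤ r := by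
  classical
  obtain ⟨T, hT, hmax⟩ := Finset.exists_max_image
    (S.powerset.filter fun T => ∀ s ∈ T, ∀ t ∈ T, s ≠ t → r < G.dist s t) Finset.card
    ⟨∅, by simp⟩
  simp only [Finset.mem_filter, Finset.mem_powerset] at hT hmax
  refine ⟨T, hT.1, hT.2, fun x hx => ?_⟩
  by_contra! hfar
  have hxT : x ∉ T := fun h => by simpa using hfar x h
  have := hmax (insert x T) ⟨Finset.insert_subset hx hT.1, fun s hs t ht hst => by
    rw [Finset.mem_insert] at hs ht
    rcases hs with rfl | hs <;> rcases ht with rfl | ht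
    · exact absurd rfl hst
    · rw [dist_comm]; exact hfar t ht
    · exact hfar s hs
    · exact hT.2 s hs t ht hst⟩
  rw [Finset.card_insert_of_notMem hxT] at this
  omega

/-- If all balls of radius `k` have at least `Y` elements and a ball of radius `5k` contains at
most half of the vertices, then the concentric ball of radius `6k` is much larger. -/
theorem ShortcutBound.card_distBall_expand {α : ℝ} (hA : G.ShortcutBound α)
    (hG : G.Connected) (hα : 0 < α) {k : ℕ} (hk : 2 ≤ k) {Y : ℝ} (hY : 0 ≤ Y)
    (hball : ∀ u, Y ≤ (G.distBall u k).card) (u : V)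
    (hhalf : ((G.distBall u (5 * k)).card : ℝ) ≤ Fintype.card V / 2) :
    Y ^ 2 * k * Fintype.card V / (4 * α) ≤ (G.distBall u (6 * k)).card := by
  classical
  obtain ⟨T, hTS, hsep, hnet⟩ := G.exists_separated_net {x | G.dist u x = 5 * k} (2 * k)
  have hTu : ∀ t ∈ T, G.dist u t = 5 * k := fun t ht => by simpa using hTS ht
  -- disjoint balls around the points of the net
  have h1 : (T.card : ℝ) * Y ≤ (G.distBall u (6 * k)).card := by
    have hdisj : (T : Set V).PairwiseDisjoint fun t => G.distBall t k := by
      intro s hs t ht hst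
      refine Finset.disjoint_left.2 fun x hx hx' => ?_
      simp only [mem_distBall] at hx hx'
      have h3 := hsep s hs t ht hst
      have h4 := hG.dist_triangle (u := s) (v := x) (w := t)
      rw [dist_comm (u := x)] at h4
      omega
    have hsub : T.biUnion (fun t => G.distBall t k) ⊆ G.distBall u (6 * k) := by
      intro x hx
      simp only [Finset.mem_biUnion, mem_distBall] at hx ⊢
      obtain ⟨t, ht, hx⟩ := hx
      have h4 := hG.dist_triangle (u := u) (v := t) (w := x)
      have := hTu t ht
      omega
    have h5 := Finset.card_le_card hsub
    rw [Finset.card_biUnion hdisj] at h5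
    calc (T.card : ℝ) * Y = ∑ t ∈ T, Y := by simp
      _ ≤ ∑ t ∈ T, ((G.distBall t k).card : ℝ) := Finset.sum_le_sum fun t _ => hball t
      _ ≤ _ := by exact_mod_cast h5
  -- the vertices outside the ball, each assigned to a point of the net
  let W : V → Finset V := fun t => {w | G.dist t w + 3 * k ≤ G.dist u w}
  have h2 : (Fintype.card V : ℝ) / 2 ≤ ∑ t ∈ T, ((W t).card : ℝ) := by
    have hsub : Finset.univ ⊆ G.distBall u (5 * k) ∪ T.biUnion W := by
      intro w _
      rw [Finset.mem_union, mem_distBall]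
      by_cases hw : G.dist u w ≤ 5 * k
      · exact Or.inl hw
      · right
        -- A geodesic to `w` crosses the sphere at `x`. Starting at a net point within `2k` of `x`
        -- instead of at `u` still saves `3k`.
        obtain ⟨x, hx, hxw⟩ := hG.exists_dist_eq_add u w (k := 5 * k) (by omega)
        obtain ⟨t, ht, htx⟩ := hnet x (by simpa using hx)
        have := hG.dist_triangle (u := t) (v := x) (w := w)
        simp only [Finset.mem_biUnion, W, Finset.mem_filter, Finset.mem_univ, true_and]
        exact ⟨t, ht, by omega⟩
    have h5 := (Finset.card_le_card hsub).trans (Finset.card_union_le _ _)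
    have h6 : (T.biUnion W).card ≤ ∑ t ∈ T, (W t).card := Finset.card_biUnion_le
    rw [Finset.card_univ] at h5
    have h7 : (Fintype.card V : ℝ) ≤ (G.distBall u (5 * k)).card + ∑ t ∈ T, ((W t).card : ℝ) := by
      exact_mod_cast h5.trans (by omega)
    linarith
  have h3 : ∀ t ∈ T, Y * (k / 2) * (W t).card ≤ α := by
    intro t ht
    -- Through the edge `ut`, the route from `x` to `w` has length at most `d(u, w) - 2k + 1`, while
    -- `d(x, w) ≥ d(u, w) - k`. The saving is at least `k - 1 ≥ k / 2`.
    have h4 := hA (G.distBall u k) (W t) u t (k - 1) (fun x hx w hw => by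
      simp only [mem_distBall, W, Finset.mem_filter, Finset.mem_univ, true_and] at hx hw
      have h5 := hG.dist_triangle (u := u) (v := x) (w := w)
      rw [dist_comm (u := x) (v := u)]
      omega)
    have h5 : ((k - 1 : ℕ) : ℝ) = k - 1 := by rw [Nat.cast_sub (by omega)]; simp
    have hk' : (2 : ℝ) ≤ k := by exact_mod_cast hk
    calc Y * (k / 2) * (W t).card
        ≤ (G.distBall u k).card * ((k - 1 : ℕ) : ℝ) * (W t).card := by
          gcongr
          · exact hball u
          · rw [h5]; linarith
      _ = (G.distBall u k).card * (W t).card * ((k - 1 : ℕ) : ℝ) := by ring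
      _ ≤ α := h4
  have h4 : Y * (k / 2) * (Fintype.card V / 2) ≤ T.card * α := by
    calc Y * (k / 2) * (Fintype.card V / 2) ≤ Y * (k / 2) * ∑ t ∈ T, ((W t).card : ℝ) := by gcongr
      _ = ∑ t ∈ T, Y * (k / 2) * (W t).card := by rw [Finset.mul_sum]
      _ ≤ ∑ t ∈ T, α := Finset.sum_le_sum h3
      _ = T.card * α := by simp
  refine le_trans ?_ h1
  rw [div_le_iff₀ (by positivity)]
  nlinarith [mul_le_mul_of_nonneg_right h4 hY]

/-- Either some ball of radius `6 ^ i * k` contains more than half of the vertices, or all of them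
have size doubly exponential in `i`. -/
theorem ShortcutBound.exists_half_or_card_distBall {α : ℝ} (hA : G.ShortcutBound α)
    (hG : G.Connected) (hα : 0 < α) {k : ℕ} (hk : 2 ≤ k)
    (hkα : 8 * α ≤ (k : ℝ) ^ 2 * Fintype.card V) (i : ℕ) :
    (∃ u, (Fintype.card V : ℝ) / 2 < (G.distBall u (6 ^ i * k)).card) ∨
      ∃ Y : ℝ, 2 ^ 2 ^ i ≤ Y ∧
        (2 : ℝ) ^ 2 ^ i * (4 * α) ≤ Y * ((6 ^ i * k : ℕ) : ℝ) * Fintype.card V ∧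
        ∀ u, Y ≤ (G.distBall u (6 ^ i * k)).card := by
  have : Nonempty V := hG.nonempty
  have hn : (0 : ℝ) < Fintype.card V := by exact_mod_cast Fintype.card_pos
  have hk' : (2 : ℝ) ≤ k := by exact_mod_cast hk
  by_cases hbig : ∃ u, (Fintype.card V : ℝ) / 2 < (G.distBall u (6 ^ i * k)).card
  · exact Or.inl hbig
  refine Or.inr ?_
  push Not at hbig
  induction i with
  | zero =>
    refine ⟨k, by simpa using hk', ?_, fun u => ?_⟩
    · simp only [pow_zero, pow_one, one_mul]
      nlinarith
    · have := hbig u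
      rcases hG.distBall_eq_univ_or u (6 ^ 0 * k) with h | h
      · rw [h, Finset.card_univ] at this
        linarith
      · have : k ≤ (G.distBall u (6 ^ 0 * k)).card := by omega
        exact_mod_cast this
  | succ i ih =>
    have hmono : ∀ {r : ℕ} (u : V), r ≤ 6 ^ (i + 1) * k →
        ((G.distBall u r).card : ℝ) ≤ Fintype.card V / 2 := fun u h =>
      le_trans (by exact_mod_cast Finset.card_le_card (distBall_mono u h)) (hbig u)
    obtain ⟨Y, hY1, hY2, hY3⟩ := ih fun u => hmono u (by rw [pow_succ]; nlinarith [Nat.zero_le (6 ^ i * k)])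
    set m := 6 ^ i * k with hm
    have hmk : k ≤ m := Nat.le_mul_of_pos_left k (by positivity)
    have hm6 : 6 ^ (i + 1) * k = 6 * m := by rw [hm]; ring
    rw [hm6] at hmono ⊢
    have hm0 : (0 : ℝ) < m := by exact_mod_cast (by omega : 0 < m)
    set P : ℝ := 2 ^ 2 ^ i with hP
    have hP1 : 1 ≤ P := one_le_pow₀ (by norm_num)
    have hPP : (2 : ℝ) ^ 2 ^ (i + 1) = P * P := by rw [hP, ← pow_add, pow_succ]; ring_nf
    rw [hPP]
    have hQ : P ≤ Y * m * Fintype.card V / (4 * α) := by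
      rw [le_div_iff₀ (by positivity)]; exact hY2
    -- `Q` is the growth factor of this round. The next one is `6 * Q ^ 2`, which is why the
    -- induction carries a lower bound for it next to that for `Y`.
    set Q := Y * m * Fintype.card V / (4 * α) with hQdef
    refine ⟨Y * Q, mul_le_mul hY1 hQ (by linarith) (by linarith), ?_, fun u => ?_⟩
    · have h1 : Y * m * Fintype.card V = Q * (4 * α) := by rw [hQdef]; field_simp
      have h2 : Y * Q * ((6 * m : ℕ) : ℝ) * Fintype.card V = 6 * (Q * Q) * (4 * α) := by
        push_cast
        linear_combination 6 * Q * h1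
      rw [h2]
      have h3 : P * P ≤ Q * Q := mul_le_mul hQ hQ (by linarith) (by linarith)
      have h4 : P * P ≤ 6 * (Q * Q) := by linarith [mul_self_nonneg Q]
      exact mul_le_mul_of_nonneg_right h4 (by positivity)
    · have := hA.card_distBall_expand hG hα (k := m) (by omega) (by linarith) hY3 u
        (hmono u (by omega))
      refine le_trans (le_of_eq ?_) this
      rw [hQdef]; ring

/-- A bound for the diameter of a connected graph without good shortcuts. -/
theorem ShortcutBound.dist_le {α : ℝ} (hA : G.ShortcutBound α) (hG : G.Connected)
    (hn : 2 ≤ Fintype.card V) (hα : (Fintype.card V : ℝ) < α) (v w : V) :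
    (G.dist v w : ℝ) ≤
      116 * (Real.logb 2 (Fintype.card V) ^ Real.logb 2 6 * √(α / Fintype.card V)) := by
  set n := Fintype.card V with hndef
  have hn' : (2 : ℝ) ≤ n := by exact_mod_cast hn
  have hα0 : 0 < α := by linarith
  set a := √(α / n) with ha
  have ha1 : 1 ≤ a := by
    rw [ha, Real.one_le_sqrt, one_le_div (by linarith)]; exact hα.le
  have haa : a * a = α / n := Real.mul_self_sqrt (by positivity)
  set l := Real.logb 2 n with hl
  have hl1 : 1 ≤ l := by
    rw [hl, Real.le_logb_iff_rpow_le (by norm_num) (by linarith)]; simpa using hn'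
  have h6 : 0 < Real.logb 2 6 := Real.logb_pos (by norm_num) (by norm_num)
  set b := l ^ Real.logb 2 6 with hb
  have hb1 : 1 ≤ b := Real.one_le_rpow hl1 h6.le
  -- The factor 3 yields `k² n ≥ 9α`, enough for the required `8α`; since `a ≥ 1`, rounding up costs
  -- at most one more `a`.
  set k := ⌈3 * a⌉₊ with hk
  have hk3 : 3 * a ≤ k := Nat.le_ceil _
  have hk4 : (k : ℝ) ≤ 4 * a := by
    have := Nat.ceil_lt_add_one (a := 3 * a) (by linarith)
    linarith
  have hk2 : 2 ≤ k := by
    have : (2 : ℝ) ≤ k := by linarith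
    exact_mod_cast this
  have hkα : 8 * α ≤ (k : ℝ) ^ 2 * n := by
    have h1 : α = a * a * n := by rw [haa]; field_simp
    have h2 : (3 * a) ^ 2 ≤ (k : ℝ) ^ 2 := by gcongr
    calc 8 * α = 8 * (a * a) * n := by rw [h1]; ring
      _ ≤ (3 * a) ^ 2 * n := by gcongr; nlinarith
      _ ≤ _ := by gcongr
  -- This many rounds make `2 ^ 2 ^ i ≥ n`, while `6 ^ i ≤ 6 * 6 ^ lg l = 6 * l ^ lg 6`.
  set i := ⌈Real.logb 2 l⌉₊ with hi
  set R := 6 ^ i * k with hR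
  have hRb : (R : ℝ) ≤ 24 * (b * a) := by
    have hll : 0 ≤ Real.logb 2 l := Real.logb_nonneg (by norm_num) hl1
    have h1 : (i : ℝ) ≤ Real.logb 2 l + 1 := (Nat.ceil_lt_add_one hll).le
    have h2 : (6 : ℝ) ^ i ≤ 6 * b := by
      calc (6 : ℝ) ^ i = (6 : ℝ) ^ (i : ℝ) := (Real.rpow_natCast _ _).symm
        _ ≤ (6 : ℝ) ^ (Real.logb 2 l + 1) := Real.rpow_le_rpow_of_exponent_le (by norm_num) h1
        _ = 6 * (6 : ℝ) ^ Real.logb 2 l := by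
          rw [Real.rpow_add (by norm_num), Real.rpow_one]; ring
        _ = 6 * b := by
          congr 1
          rw [hb]
          nth_rw 1 [← Real.rpow_logb (b := 2) (x := 6) (by norm_num) (by norm_num) (by norm_num)]
          nth_rw 2 [← Real.rpow_logb (b := 2) (x := l) (by norm_num) (by norm_num) (by linarith)]
          rw [← Real.rpow_mul (by norm_num), ← Real.rpow_mul (by norm_num), mul_comm]
    rw [hR]
    push_cast
    calc (6 : ℝ) ^ i * k ≤ (6 * b) * (4 * a) := by gcongr
      _ = _ := by ring
  obtain ⟨u, hu⟩ : ∃ u, (n : ℝ) / 2 < (G.distBall u R).card := by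
    rcases hA.exists_half_or_card_distBall hG hα0 hk2 hkα i with h | ⟨Y, hY1, -, hY3⟩
    · exact h
    · refine ⟨v, lt_of_lt_of_le ?_ (hY3 v)⟩
      refine lt_of_lt_of_le (by linarith : (n : ℝ) / 2 < n) (le_trans ?_ hY1)
      have h1 : l ≤ (2 : ℝ) ^ i := by
        rw [← Real.rpow_natCast, ← Real.logb_le_iff_le_rpow (by norm_num) (by linarith)]
        exact Nat.le_ceil _
      have h2 : (n : ℝ) ≤ (2 : ℝ) ^ ((2 ^ i : ℕ) : ℝ) := by
        rw [← Real.logb_le_iff_le_rpow (by norm_num) (by linarith)]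
        push_cast
        exact h1
      rwa [Real.rpow_natCast] at h2
  -- The constant is `48 + 8 + 1 + 1`, from `2R + 2k + 1 + g` with `g ≤ a`.
  have key : ∀ v, (G.dist u v : ℝ) ≤ 58 * (b * a) := by
    intro v
    have hab : a ≤ b * a := by nlinarith
    rcases hG.distBall_eq_univ_or v k with h | h
    · have : u ∈ G.distBall v k := h ▸ Finset.mem_univ u
      rw [mem_distBall, dist_comm] at this
      have : (G.dist u v : ℝ) ≤ k := by exact_mod_cast this
      linarith
    -- Through the edge `vu`, such pairs are within `k + 1 + R`; without it they are at least `d(u,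
    -- v) - R - k` apart.
    · have h1 := hA (G.distBall v k) (G.distBall u R) v u (G.dist u v - (2 * R + 2 * k + 1))
      by_cases hD : G.dist u v ≤ 2 * R + 2 * k + 1
      · have : (G.dist u v : ℝ) ≤ 2 * R + 2 * k + 1 := by exact_mod_cast hD
        linarith
      push Not at hD
      have h2 := h1 fun x hx w hw => by
        rw [mem_distBall] at hx hw
        have h3 := hG.dist_triangle (u := u) (v := w) (w := v)
        have h4 := hG.dist_triangle (u := w) (v := x) (w := v)
        rw [dist_comm (u := w) (v := x)] at h4
        rw [dist_comm] at hx
        omega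
      rw [Nat.cast_sub hD.le] at h2
      push_cast at h2
      set g : ℝ := (G.dist u v : ℝ) - (2 * R + 2 * k + 1) with hg
      have hg0 : 0 ≤ g := by
        have : (2 * R + 2 * k + 1 : ℝ) ≤ G.dist u v := by exact_mod_cast hD.le
        linarith
      have hkk : (k : ℝ) ≤ (G.distBall v k).card := by
        exact_mod_cast (by omega : k ≤ (G.distBall v k).card)
      have h5 : 3 * a * (n / 2) * g ≤ α := by
        refine le_trans ?_ h2
        gcongr
        exact hk3.trans hkk
      have h6 : g ≤ a := by
        have h1 : α = a * a * n := by rw [haa]; field_simp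
        rw [h1] at h5
        have : a * n * (3 / 2 * g) ≤ a * n * a := by linarith
        have := le_of_mul_le_mul_left this (by positivity)
        linarith
      linarith
  have h1 := key v
  have h2 := key w
  have h3 : (G.dist v w : ℝ) ≤ G.dist u v + G.dist u w := by
    have := hG.dist_triangle (u := v) (v := u) (w := w)
    rw [dist_comm (u := v) (v := u)] at this
    exact_mod_cast this
  linarith

end SimpleGraph

/-! ### Counting edges by short cycles and girth -/

namespace SimpleGraph

variable {V : Type*} {G : SimpleGraph V}

/-- If the ends of a deleted edge `e` are joined by a path of length at most `L`, then a walk can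
be rerouted at the cost of `L` for every occurrence of `e`. -/
theorem edist_deleteEdges_le_length [DecidableEq V] {e : Sym2 V} {L : ℕ∞}
    (he : ∀ x y, s(x, y) = e → (G.deleteEdges {e}).edist x y ≤ L) {u v : V} (p : G.Walk u v) :
    (G.deleteEdges {e}).edist u v ≤ p.length + p.edges.count e * L := by
  induction p with
  | nil => simp
  | @cons u v w h p ih =>
    refine (SimpleGraph.edist_triangle (v := v)).trans ?_
    rw [Walk.edges_cons, List.count_cons, Walk.length_cons]
    by_cases hu : s(u, v) = e
    · have := he u v hu
      simp only [hu, beq_self_eq_true, if_true]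
      calc _ ≤ L + (p.length + p.edges.count e * L) := add_le_add this ih
        _ ≤ L + (p.length + p.edges.count e * L) + 1 := le_self_add
        _ = _ := by push_cast; ring
    · have : (G.deleteEdges {e}).edist u v ≤ 1 :=
        edist_le_one_iff_adj_or_eq.2 (Or.inl (by simp [deleteEdges_adj, h, hu]))
      simp only [beq_iff_eq, hu, if_false]
      calc _ ≤ 1 + (p.length + p.edges.count e * L) := add_le_add this ih
        _ = _ := by push_cast; ring

/-- A geodesic from `v` to a vertex that is no farther than `y` does not use any edge at `y`. -/
theorem edist_deleteEdges_le_of_edist_le {v x y z : V} (hzy : z ≠ y)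
    (h : G.edist v z ≤ G.edist v y) :
    (G.deleteEdges {s(x, y)}).edist v z ≤ G.edist v z := by
  classical
  by_cases htop : G.edist v z = ⊤
  · rw [htop]; exact le_top
  obtain ⟨p, hp⟩ := exists_walk_of_edist_ne_top htop
  -- If the geodesic to `z` passed through `y ≠ z`, then `y` would be strictly nearer to `v` than
  -- `z`.
  have hy : y ∉ p.support := by
    intro hy
    have h1 := Walk.length_takeUntil_lt_length hy hzy.symm
    have h2 := edist_le (p.takeUntil y hy)
    have h3 : (p.length : ℕ∞) ≤ (p.takeUntil y hy).length := hp.le.trans (h.trans h2)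
    exact absurd (by exact_mod_cast h3) (not_le.2 h1)
  have he : s(x, y) ∉ p.edges := fun he => hy (p.snd_mem_support_of_mem_edges he)
  have := edist_le (p.toDeleteEdge s(x, y) he)
  rw [← hp]
  simpa using this

/-- The ends of every edge are far apart after the edge is deleted (`G` has large girth). -/
def NoShortCycle (G : SimpleGraph V) (L : ℕ∞) : Prop :=
  ∀ x y, G.Adj x y → L < (G.deleteEdges {s(x, y)}).edist x y

theorem NoShortCycle.mono {H : SimpleGraph V} {L : ℕ∞} (hG : G.NoShortCycle L) (h : H ≤ G) :
    H.NoShortCycle L := fun x y hxy =>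
  (hG x y (h hxy)).trans_le (edist_anti (deleteEdges_mono h))

/-- In a graph of large girth, a vertex near `v` has at most one neighbour that is not farther
from `v`. -/
theorem NoShortCycle.unique_parent {r : ℕ} (hG : G.NoShortCycle (2 * r + 1 : ℕ))
    {v x x' y : V} (hx : G.Adj x y) (hx' : G.Adj x' y) (hxy : G.edist v x ≤ G.edist v y)
    (hxy' : G.edist v x' ≤ G.edist v y) (hxr : G.edist v x ≤ r) (hxr' : G.edist v x' ≤ r) :
    x = x' := by
  by_contra hne
  refine absurd (hG x y hx) (not_lt.2 ?_)
  have h1 := edist_deleteEdges_le_of_edist_le (x := x) hx.ne hxy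
  have h2 := edist_deleteEdges_le_of_edist_le (x := x) hx'.ne hxy'
  have h3 : (G.deleteEdges {s(x, y)}).edist x' y ≤ 1 :=
    edist_le_one_iff_adj_or_eq.2 (Or.inl (by
      rw [deleteEdges_adj]
      refine ⟨hx', fun h => hne ?_⟩
      simp only [Set.mem_singleton_iff, Sym2.eq_iff] at h
      rcases h with h | h
      · exact h.1.symm
      · exact absurd h.1 hx'.ne))
  rw [SimpleGraph.edist_comm] at h1
  -- The detour `x – v – x' – y` avoids the edge `xy` and has length at most `r + r + 1`.
  calc _ ≤ _ := SimpleGraph.edist_triangle (v := v)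
    _ ≤ _ := add_le_add le_rfl (SimpleGraph.edist_triangle (v := x'))
    _ ≤ (r : ℕ∞) + (r + 1) := add_le_add (h1.trans hxr) (add_le_add (h2.trans hxr') h3)
    _ = _ := by push_cast; ring

/-- A sequence that starts at a positive value and stays at most `n` must fail to double within
`Nat.log 2 n` steps. -/
theorem _root_.exists_le_two_mul_of_le {f : ℕ → ℕ} {n : ℕ} (h0 : 0 < f 0) (hn : ∀ r, f r ≤ n) :
    ∃ r ≤ Nat.log 2 n, f (r + 1) ≤ 2 * f r := by
  by_contra! h
  have key : ∀ r ≤ Nat.log 2 n + 1, 2 ^ r ≤ f r := by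
    intro r
    induction r with
    | zero => intro _; simpa using Nat.succ_le_of_lt h0
    | succ r ih =>
      intro hr
      have h1 := h r (by omega)
      have h2 := ih (by omega)
      rw [pow_succ]
      omega
  have h1 := key _ le_rfl
  have h2 := hn (Nat.log 2 n + 1)
  have h3 := Nat.lt_pow_succ_log_self (b := 2) (by norm_num) n
  rw [Nat.succ_eq_add_one] at h3
  omega

variable [Fintype V]

/-- Some ball `B k` with `k ≤ log n` does not more than double at the next radius. Each edge
touching it has its farther end in `B (k + 1)`, and by `unique_parent` that end determines the edge,
so there are at most `2 |B k|` of them. Removing them leaves a graph supported on `S \ B k`, to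
which induction applies. -/
theorem NoShortCycle.card_edgeFinset_le_of_support {r : ℕ} {S : Finset V} [Fintype G.edgeSet]
    (hr : Nat.log 2 (Fintype.card V) ≤ r) (hG : G.NoShortCycle (2 * r + 1 : ℕ))
    (hS : ∀ x y, G.Adj x y → x ∈ S) : G.edgeFinset.card ≤ 2 * S.card := by
  classical
  induction hm : S.card using Nat.strong_induction_on generalizing S G with
  | _ m ih =>
  subst hm
  rcases S.eq_empty_or_nonempty with rfl | ⟨v, hv⟩
  · have : G.edgeFinset = ∅ := by
      rw [Finset.eq_empty_iff_forall_notMem]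
      intro e
      induction e with
      | _ x y => rw [mem_edgeFinset, mem_edgeSet]; exact fun h => by simpa using hS x y h
    simp [this]
  -- The graph may be disconnected here; with `edist` the balls omit unreachable vertices, whose
  -- `dist` would be 0.
  let B : ℕ → Finset V := fun k => {w | G.edist v w ≤ k}
  have hB : ∀ k w, w ∈ B k ↔ G.edist v w ≤ k := fun k w => by simp [B]
  have hvB : ∀ k, v ∈ B k := fun k => by simp [hB]
  have hBS : ∀ k, B k ⊆ S := by
    intro k w hw
    rw [hB] at hw
    by_cases hvw : w = v
    · exact hvw ▸ hv
    have : G.edist v w ≠ ⊤ := fun h => by rw [h] at hw; exact absurd hw (by simp)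
    obtain ⟨p⟩ := (reachable_of_edist_ne_top this).symm
    cases p with
    | nil => exact absurd rfl hvw
    | cons h _ => exact hS _ _ h
  obtain ⟨k, hk, hgrow⟩ := exists_le_two_mul_of_le (f := fun k => (B k).card)
    (n := Fintype.card V) (Finset.card_pos.2 ⟨v, hvB 0⟩) (fun k => Finset.card_le_univ _)
  have hkr : k ≤ r := hk.trans hr
  have hkr' : (k : ℕ∞) ≤ r := by exact_mod_cast hkr
  let H : SimpleGraph V := G.deleteEdges {e | ∃ x ∈ B k, x ∈ e}
  have hH : H.edgeFinset.card ≤ 2 * (S \ B k).card := by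
    refine ih _ ?_ (hG.mono (deleteEdges_le _)) (fun x y hxy => ?_) rfl
    · exact Finset.card_lt_card (Finset.sdiff_ssubset (hBS k) ⟨v, hvB k⟩)
    · rw [deleteEdges_adj] at hxy
      refine Finset.mem_sdiff.2 ⟨hS x y hxy.1, fun hx => hxy.2 ⟨x, hx, by simp⟩⟩
  -- the edges at the ball are counted by their farther ends
  have hT : (G.edgeFinset \ H.edgeFinset).card ≤ (B (k + 1)).card := by
    have hpar : ∀ e ∈ G.edgeFinset \ H.edgeFinset, ∃ x y, e = s(x, y) ∧ G.Adj x y ∧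
        G.edist v x ≤ k ∧ G.edist v x ≤ G.edist v y := by
      intro e
      induction e with
      | _ a b =>
      intro he
      simp only [Finset.mem_sdiff, mem_edgeFinset, mem_edgeSet, H, deleteEdges_adj,
        Set.mem_ofPred_eq, not_and, not_not, Sym2.mem_iff] at he
      obtain ⟨x, hx, hxe⟩ := he.2 he.1
      rw [hB] at hx
      rcases le_total (G.edist v a) (G.edist v b) with hab | hab
      · refine ⟨a, b, rfl, he.1, ?_, hab⟩
        rcases hxe with rfl | rfl
        · exact hx
        · exact hab.trans hx
      · refine ⟨b, a, Sym2.eq_swap, he.1.symm, ?_, hab⟩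
        rcases hxe with rfl | rfl
        · exact hab.trans hx
        · exact hx
    have : Nonempty V := ⟨v⟩
    choose! f g hfg using hpar
    refine Finset.card_le_card_of_injOn g (fun e he => ?_) (fun e he e' he' hee => ?_)
    · obtain ⟨-, h1, h2, -⟩ := hfg e he
      rw [Finset.mem_coe, hB]
      refine (SimpleGraph.edist_triangle (v := f e)).trans ?_
      rw [edist_eq_one_iff_adj.2 h1]
      push_cast
      gcongr
    · obtain ⟨h0, h1, h2, h3⟩ := hfg e he
      obtain ⟨h0', h1', h2', h3'⟩ := hfg e' he'
      rw [← hee] at h0' h1' h3'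
      rw [h0, h0', hG.unique_parent h1 h1' h3 h3' (h2.trans hkr') (h2'.trans hkr')]
  have h1 : G.edgeFinset.card ≤ (G.edgeFinset \ H.edgeFinset).card + H.edgeFinset.card := by
    exact Finset.card_le_card_sdiff_add_card
  have h2 := Finset.card_sdiff_of_subset (hBS k)
  have h3 := Finset.card_le_card (hBS k)
  have h4 : (B (k + 1)).card ≤ 2 * (B k).card := hgrow
  omega

/-- A graph of girth larger than about `2 log n` has at most `2n` edges. -/
theorem NoShortCycle.card_edgeFinset_le [Fintype G.edgeSet]
    (hG : G.NoShortCycle (2 * Nat.log 2 (Fintype.card V) + 1 : ℕ)) :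
    G.edgeFinset.card ≤ 2 * Fintype.card V := by
  rw [← Finset.card_univ]
  exact hG.card_edgeFinset_le_of_support le_rfl (by simp)

/-- Deleting an edge of `G` increases the distances by at least `α` in total. -/
def DeletionBound (G : SimpleGraph V) (α : ℝ) : Prop :=
  ∀ e ∈ G.edgeSet, ∀ δ : V → ℕ,
    (∀ i, ∑ j, ((G.deleteEdges {e}).edist i j) ≤ ∑ j, G.edist i j + δ i) → α ≤ ∑ i, (δ i : ℝ)

/-- The number of edges of a graph without superfluous edges is bounded in terms of the sum of
its distances. -/
theorem DeletionBound.mul_card_edgeFinset_le {α : ℝ} (hB : G.DeletionBound α) (hG : G.Connected)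
    (hα : 0 ≤ α) [Fintype G.edgeSet] :
    α * G.edgeFinset.card ≤ 2 * α * Fintype.card V +
      (2 * Nat.log 2 (Fintype.card V) + 1 : ℕ) * ∑ i, ∑ j, (G.dist i j : ℝ) := by
  classical
  set L : ℕ := 2 * Nat.log 2 (Fintype.card V) + 1 with hL
  -- These are the edges on a cycle of length at most `L + 1`; the remaining ones have no short
  -- detour even in `G`, hence none in `bad`.
  let good : Finset (Sym2 V) := G.edgeFinset.filter fun e =>
    ∀ x y, s(x, y) = e → (G.deleteEdges {e}).edist x y ≤ L
  let bad : SimpleGraph V := G.deleteEdges good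
  have hbad : bad.edgeFinset.card ≤ 2 * Fintype.card V := by
    refine NoShortCycle.card_edgeFinset_le fun x y hxy => ?_
    rw [← hL]
    by_contra! hle
    have hle' : (G.deleteEdges {s(x, y)}).edist x y ≤ L :=
      (edist_anti (deleteEdges_mono (deleteEdges_le _))).trans hle
    simp only [bad, deleteEdges_adj, good, Finset.coe_filter, mem_edgeFinset, Set.mem_ofPred_eq,
      mem_edgeSet, not_and] at hxy
    refine hxy.2 hxy.1 fun a b hab => ?_
    rcases Sym2.eq_iff.1 hab with ⟨rfl, rfl⟩ | ⟨rfl, rfl⟩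
    · exact hle'
    · rw [SimpleGraph.edist_comm]; exact hle'
  have hcard : G.edgeFinset.card ≤ good.card + bad.edgeFinset.card := by
    refine (Finset.card_le_card fun e he => ?_).trans (Finset.card_union_le _ _)
    rw [Finset.mem_union]
    by_cases hg : e ∈ good
    · exact Or.inl hg
    · refine Or.inr ?_
      rw [mem_edgeFinset] at he ⊢
      simp only [bad, edgeSet_deleteEdges]
      exact ⟨he, hg⟩
  choose p hp using hG.exists_walk_length_eq_dist
  have hgood : ∀ e ∈ good, α ≤ L * ∑ i, ∑ j, ((p i j).edges.count e : ℝ) := by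
    intro e he
    simp only [good, Finset.mem_filter, mem_edgeFinset] at he
    -- Every use of `e` by a chosen geodesic from `i` is replaced by a detour of length at most `L`.
    have := hB e he.1 (fun i => ∑ j, (p i j).edges.count e * L) fun i => by
      push_cast
      rw [← Finset.sum_add_distrib]
      refine Finset.sum_le_sum fun j _ => ?_
      have := edist_deleteEdges_le_length he.2 (p i j)
      rwa [hp, (hG.preconnected i j).coe_dist_eq_edist] at this
    refine this.trans (le_of_eq ?_)
    push_cast
    simp only [Finset.mul_sum, mul_comm]
  have hcount : ∑ e ∈ good, ∑ i, ∑ j, ((p i j).edges.count e : ℝ) ≤ ∑ i, ∑ j, (G.dist i j : ℝ) := by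
    rw [Finset.sum_comm]
    refine Finset.sum_le_sum fun i _ => ?_
    rw [Finset.sum_comm]
    refine Finset.sum_le_sum fun j _ => ?_
    rw [← hp i j, ← Walk.length_edges]
    have : ∑ e ∈ good, (p i j).edges.count e ≤ (p i j).edges.length := by
      have h1 := Multiset.sum_count_eq_card (s := Finset.univ) (m := ((p i j).edges : Multiset (Sym2 V)))
        (by simp)
      simp only [Multiset.coe_count, Multiset.coe_card] at h1
      rw [← h1]
      exact Finset.sum_le_sum_of_subset (Finset.subset_univ _)
    exact_mod_cast this
  have h1 : α * good.card ≤ L * ∑ i, ∑ j, (G.dist i j : ℝ) := by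
    calc α * good.card = ∑ e ∈ good, α := by simp [mul_comm]
      _ ≤ ∑ e ∈ good, L * ∑ i, ∑ j, ((p i j).edges.count e : ℝ) := Finset.sum_le_sum hgood
      _ = L * ∑ e ∈ good, ∑ i, ∑ j, ((p i j).edges.count e : ℝ) := by rw [Finset.mul_sum]
      _ ≤ _ := by gcongr
  have h2 : (G.edgeFinset.card : ℝ) ≤ good.card + 2 * Fintype.card V := by
    exact_mod_cast hcard.trans (by omega)
  calc α * G.edgeFinset.card ≤ α * (good.card + 2 * Fintype.card V) := by gcongr
    _ ≤ _ := by linarith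

end SimpleGraph

/-! ### Passing between extended and finite distances -/

theorem ENat.toENNReal_sum {ι : Type*} (S : Finset ι) (f : ι → ℕ∞) :
    ((∑ i ∈ S, f i : ℕ∞) : ℝ≥0∞) = ∑ i ∈ S, (f i : ℝ≥0∞) :=
  map_sum ENat.toENNRealRingHom f S

namespace SimpleGraph

variable {V : Type*} {G : SimpleGraph V}

theorem ediam_le_ofReal (hG : G.Connected) {D : ℝ} (h : ∀ u v, (G.dist u v : ℝ) ≤ D) :
    (G.ediam : ℝ≥0∞) ≤ ENNReal.ofReal D := by
  have h1 : G.ediam ≤ (⌊D⌋₊ : ℕ∞) := ediam_le_of_edist_le fun u v => by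
    rw [← (hG.preconnected u v).coe_dist_eq_edist]
    exact_mod_cast Nat.le_floor (h u v)
  obtain ⟨v⟩ := hG.nonempty
  have hD : 0 ≤ D := by simpa using h v v
  calc (G.ediam : ℝ≥0∞) ≤ ((⌊D⌋₊ : ℕ∞) : ℝ≥0∞) := by exact_mod_cast h1
    _ = ENNReal.ofReal ⌊D⌋₊ := by simp
    _ ≤ _ := ENNReal.ofReal_le_ofReal (Nat.floor_le hD)

theorem Connected.sum_edist_eq [Fintype V] (hG : G.Connected) (i : V) :
    ∑ j, (G.edist i j : ℝ≥0∞) = ((∑ j, G.dist i j : ℕ) : ℝ≥0∞) := by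
  rw [Nat.cast_sum]
  refine Finset.sum_congr rfl fun j _ => ?_
  rw [← (hG.preconnected i j).coe_dist_eq_edist]
  simp

end SimpleGraph

/-! ### Effect of a deviation on networks and payments -/

namespace JointStrategy

theorem IsDeviation.apply_eq {V : Type*} {G : SimpleGraph V} {s t : JointStrategy G} {C : Set V}
    {e f : G.edgeSet} (h : IsDeviation C e s t) (hf : f ≠ e) (i : V) : t i f = s i f := by
  by_contra hne
  exact hf (h i f hne).2

variable {V : Type*} [Fintype V] {G : SimpleGraph V} {α : ℝ≥0} {s t : JointStrategy G}

theorem edgeSet_graph (α : ℝ≥0) (s : JointStrategy G) :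
    (s.graph α).edgeSet = Subtype.val '' builtEdges α s := by
  rw [graph, SimpleGraph.edgeSet_fromEdgeSet, sdiff_eq_left, Set.disjoint_left]
  rintro _ ⟨e, -, rfl⟩ h
  exact G.not_isDiag_of_mem_edgeSet e.2 h

theorem mem_edgeSet_graph {e : G.edgeSet} :
    (e : Sym2 V) ∈ (s.graph α).edgeSet ↔ e ∈ builtEdges α s := by
  rw [edgeSet_graph]
  exact Subtype.val_injective.mem_set_image

namespace IsDeviation

variable {C : Set V} {e f : G.edgeSet}

theorem offered_eq (h : IsDeviation C e s t) (hf : f ≠ e) : t.offered f = s.offered f :=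
  Finset.sum_congr rfl fun i _ => h.apply_eq hf i

theorem mem_builtEdges_iff (h : IsDeviation C e s t) (hf : f ≠ e) :
    f ∈ builtEdges α t ↔ f ∈ builtEdges α s := by
  simp only [builtEdges, Set.mem_ofPred_eq, h.offered_eq hf]

theorem payment_eq (h : IsDeviation C e s t) (hf : f ≠ e) (i : V) :
    payment α t i f = payment α s i f := by
  simp only [payment, h.offered_eq hf, h.apply_eq hf i]

/-- This holds whether or not `e` is built before or after the deviation, so it serves both for
adding and for withdrawing. -/
theorem deleteEdges_le (h : IsDeviation C e s t) :
    (s.graph α).deleteEdges {(e : Sym2 V)} ≤ t.graph α := by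
  rw [← SimpleGraph.edgeSet_subset_edgeSet, SimpleGraph.edgeSet_deleteEdges, edgeSet_graph,
    edgeSet_graph]
  rintro _ ⟨⟨f, hf, rfl⟩, hfe⟩
  have : f ≠ e := fun h => hfe (by simp [h])
  exact ⟨f, (h.mem_builtEdges_iff this).2 hf, rfl⟩

open Classical in
theorem sum_payment_erase_eq (h : IsDeviation C e s t) (i : V) :
    ∑ f ∈ ({f | f ∈ builtEdges α t} : Finset G.edgeSet).erase e, payment α t i f =
      ∑ f ∈ ({f | f ∈ builtEdges α s} : Finset G.edgeSet).erase e, payment α s i f := by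
  refine Finset.sum_congr ?_ fun f hf => h.payment_eq (Finset.ne_of_mem_erase hf) i
  ext f
  simp only [Finset.mem_erase, Finset.mem_filter, Finset.mem_univ, true_and]
  exact and_congr_right fun hf => h.mem_builtEdges_iff hf

open Classical in
/-- A deviation changes the payments of a player by the difference of the payments for `e`. -/
theorem sum_payment_add (h : IsDeviation C e s t) (i : V) :
    ∑ f with f ∈ builtEdges α t, payment α t i f +
        (if e ∈ builtEdges α s then payment α s i e else 0) =
      ∑ f with f ∈ builtEdges α s, payment α s i f +
        (if e ∈ builtEdges α t then payment α t i e else 0) := by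
  have key : ∀ r : JointStrategy G, ∑ f with f ∈ builtEdges α r, payment α r i f =
      ∑ f ∈ ({f | f ∈ builtEdges α r} : Finset G.edgeSet).erase e, payment α r i f +
        (if e ∈ builtEdges α r then payment α r i e else 0) := by
    intro r
    split_ifs with hr
    · rw [Finset.sum_erase_add]
      simpa using hr
    · rw [Finset.erase_eq_of_notMem (by simpa using hr), add_zero]
  rw [key s, key t, h.sum_payment_erase_eq]
  ring

end IsDeviation

theorem payment_le (α : ℝ≥0) (s : JointStrategy G) (i : V) (e : G.edgeSet) :
    payment α s i e ≤ s i e := by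
  unfold payment
  split_ifs with h
  · rw [mul_div_right_comm]
    exact mul_le_of_le_one_left zero_le (div_le_one_of_le₀ h.le zero_le)
  · exact le_rfl

theorem sum_payment {e : G.edgeSet} (he : e ∈ builtEdges α s) : ∑ i, payment α s i e = α := by
  have he : α ≤ s.offered e := he
  unfold payment
  split_ifs with h
  · rw [← Finset.sum_div, ← Finset.mul_sum]
    exact mul_div_cancel_right₀ α (zero_le.trans_lt h).ne'
  · exact le_antisymm (not_lt.1 h) he

/-! ### The two equilibrium conditions -/

/-- No player profits from withdrawing the offer for a created edge. -/
theorem IsCollaborativeEquilibrium.deletionBound (hs : s.IsCollaborativeEquilibrium α) :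
    (s.graph α).DeletionBound α := by
  classical
  intro e he δ hδ
  rw [edgeSet_graph] at he
  obtain ⟨e, he, rfl⟩ := he
  by_contra! hlt
  have hlt' : ∑ i, (δ i : ℝ≥0) < ∑ i, payment α s i e := by
    rw [sum_payment he]
    exact_mod_cast hlt
  obtain ⟨i, -, hi⟩ := Finset.exists_lt_of_sum_lt hlt'
  -- Player `i` pays more than `δ i` for `e` and withdraws. If the other offers still suffice, `e`
  -- survives, which only helps `i`.
  set t : JointStrategy G := Function.update s i (Function.update (s i) e 0) with ht
  have hdev : IsDeviation {i} e s t := by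
    intro j f hne
    by_cases hj : j = i
    · subst hj
      refine ⟨rfl, ?_⟩
      by_contra hf
      simp [ht, hf] at hne
    · simp [ht, hj] at hne
  obtain ⟨j, rfl, hj⟩ := hs.2 e {i} ⟨i, rfl⟩ t hdev
  have hpay := hdev.sum_payment_add (α := α) j
  have h0 : payment α t j e = 0 := le_antisymm ((payment_le α t j e).trans (by simp [ht])) zero_le
  rw [if_pos he, h0, ite_self, add_zero] at hpay
  have hdist : ∑ k, ((t.graph α).edist j k : ℝ≥0∞) ≤
      ∑ k, ((s.graph α).edist j k : ℝ≥0∞) + (δ j : ℝ≥0∞) := by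
    have h1 : ∑ k, (t.graph α).edist j k ≤ ∑ k, (s.graph α).edist j k + δ j :=
      (Finset.sum_le_sum fun k _ => SimpleGraph.edist_anti hdev.deleteEdges_le).trans (hδ j)
    have h2 := ENat.toENNReal_mono h1
    simpa [ENat.toENNReal_sum] using h2
  refine absurd hj (not_le.2 ?_)
  unfold playerCost
  rw [hs.1.sum_edist_eq] at hdist ⊢
  rw [← hpay]
  refine (add_le_add le_rfl hdist).trans_lt ?_
  have h3 : (δ j : ℝ≥0∞) < (payment α s j e : ℝ≥0∞) := by exact_mod_cast hi
  rw [ENNReal.coe_add, add_assoc, add_comm (payment α s j e : ℝ≥0∞)]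
  refine ENNReal.add_lt_add_left ENNReal.coe_ne_top ?_
  exact ENNReal.add_lt_add_left (ENNReal.natCast_ne_top _) h3

/-- No coalition profits from creating an additional edge at equal shares. -/
theorem IsCollaborativeEquilibrium.shortcutBound {s : JointStrategy (⊤ : SimpleGraph V)}
    (hs : s.IsCollaborativeEquilibrium α) : (s.graph α).ShortcutBound α := by
  classical
  intro X W u v g hg
  by_contra! hlt
  have hG := hs.1
  have hpos : (0 : ℝ) < X.card * W.card * g := lt_of_le_of_lt α.2 hlt
  have hX : 0 < X.card := Nat.pos_of_ne_zero fun h => by simp [h] at hpos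
  have hW : 0 < W.card := Nat.pos_of_ne_zero fun h => by simp [h] at hpos
  have hg0 : 0 < g := Nat.pos_of_ne_zero fun h => by simp [h] at hpos
  obtain ⟨x₀, hx₀⟩ := Finset.card_pos.1 hX
  obtain ⟨w₀, hw₀⟩ := Finset.card_pos.1 hW
  have h0 := hg x₀ hx₀ w₀ hw₀
  have h1 := hG.dist_triangle (u := x₀) (v := u) (w := w₀)
  have h2 := hG.dist_triangle (u := u) (v := v) (w := w₀)
  -- A saving `g ≥ 1` forces `d(u, v) ≥ g + 1 ≥ 2`, so `uv` is an edge of the host graph that is not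
  -- yet built.
  have huv : u ≠ v := by
    rintro rfl
    omega
  have hnadj : ¬ (s.graph α).Adj u v := fun h => by
    rw [← SimpleGraph.dist_eq_one_iff_adj] at h
    omega
  let e : (⊤ : SimpleGraph V).edgeSet := ⟨s(u, v), huv⟩
  have hes : e ∉ builtEdges α s := fun h => hnadj (mem_edgeSet_graph.2 h)
  -- Outsiders may also offer something for `e`, so the total can exceed `α`; scaling then only
  -- lowers the members' payments.
  let t : JointStrategy (⊤ : SimpleGraph V) := fun i f =>
    if i ∈ X ∧ f = e then α / X.card else s i f
  have hdev : IsDeviation X e s t := by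
    intro i f hne
    by_contra h
    exact hne (if_neg h)
  have hX0 : (X.card : ℝ≥0) ≠ 0 := by exact_mod_cast hX.ne'
  have het : e ∈ builtEdges α t := by
    calc α = ∑ i ∈ X, t i e := by
          rw [Finset.sum_congr rfl fun i hi => if_pos ⟨hi, rfl⟩, Finset.sum_const, nsmul_eq_mul,
            mul_div_cancel₀ α hX0]
      _ ≤ ∑ i, t i e := Finset.sum_le_sum_of_subset (Finset.subset_univ _)
  have hle : s.graph α ≤ t.graph α := by
    refine le_trans (le_of_eq ?_) hdev.deleteEdges_le
    rw [SimpleGraph.deleteEdges_eq_self.2]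
    rw [Set.disjoint_singleton_right]
    exact hnadj
  have hadj : (t.graph α).edist u v ≤ 1 :=
    SimpleGraph.edist_le_one_iff_adj_or_eq.2 (Or.inl (mem_edgeSet_graph.2 het))
  have hst : ∀ a b, (t.graph α).edist a b ≤ (s.graph α).dist a b := fun a b =>
    (SimpleGraph.edist_anti hle).trans (hG.preconnected a b).coe_dist_eq_edist.ge
  obtain ⟨i, hi, hcost⟩ := hs.2 e X ⟨x₀, hx₀⟩ t hdev
  have hi : i ∈ X := hi
  refine absurd hcost (not_le.2 ?_)
  have hpay := hdev.sum_payment_add (α := α) i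
  rw [if_neg hes, if_pos het, add_zero] at hpay
  have hti : payment α t i e ≤ α / X.card :=
    (payment_le α t i e).trans (le_of_eq (if_pos ⟨hi, rfl⟩))
  have hdist : ∑ j, (t.graph α).edist i j + (W.card * g : ℕ) ≤ (∑ j, (s.graph α).dist i j : ℕ) := by
    have h3 : (W.card * g : ℕ) = ∑ j, if j ∈ W then g else 0 := by simp
    rw [h3, Nat.cast_sum, Nat.cast_sum, ← Finset.sum_add_distrib]
    refine Finset.sum_le_sum fun j _ => ?_
    split_ifs with hj
    · refine le_trans ?_ (Nat.cast_le.2 (hg i hi j hj))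
      push_cast
      gcongr
      exact SimpleGraph.edist_triangle.trans
        (add_le_add (SimpleGraph.edist_triangle.trans (add_le_add (hst i u) hadj)) (hst v j))
    · simpa using hst i j
  have hdist' : ∑ j, ((t.graph α).edist i j : ℝ≥0∞) + ((W.card * g : ℕ) : ℝ≥0∞) ≤
      ((∑ j, (s.graph α).dist i j : ℕ) : ℝ≥0∞) := by
    have h2 := ENat.toENNReal_mono hdist
    rw [ENat.toENNReal_add, ENat.toENNReal_sum] at h2
    exact h2
  have hshare : α / X.card < ((W.card * g : ℕ) : ℝ≥0) := by
    rw [div_lt_iff₀ (by exact_mod_cast hX), ← NNReal.coe_lt_coe]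
    push_cast
    linarith
  unfold playerCost
  rw [hG.sum_edist_eq, hpay, ENNReal.coe_add, add_assoc]
  refine ENNReal.add_lt_add_left ENNReal.coe_ne_top (lt_of_lt_of_le ?_ hdist')
  rw [add_comm]
  refine ENNReal.add_lt_add_left ?_ ?_
  · exact ((le_self_add.trans hdist').trans_lt (ENNReal.natCast_lt_top _)).ne
  · exact_mod_cast hti.trans_lt hshare

/-! ### Comparing equilibrium costs with the optimum -/

theorem ncard_builtEdges (α : ℝ≥0) (s : JointStrategy G) [Fintype (s.graph α).edgeSet] :
    (builtEdges α s).ncard = (s.graph α).edgeFinset.card := by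
  rw [← Set.ncard_coe_finset, SimpleGraph.coe_edgeFinset, edgeSet_graph,
    Set.ncard_image_of_injective _ Subtype.val_injective]

theorem totalCost_eq_ofReal (h : (s.graph α).Connected) [Fintype (s.graph α).edgeSet] :
    totalCost α s = ENNReal.ofReal (α * (s.graph α).edgeFinset.card +
      ∑ i, ∑ j, ((s.graph α).dist i j : ℝ)) := by
  rw [totalCost, ncard_builtEdges, Finset.sum_congr rfl fun i _ => h.sum_edist_eq i,
    ENNReal.ofReal_add (by positivity) (by positivity), ENNReal.ofReal_mul (by positivity),
    ENNReal.ofReal_coe_nnreal, ENNReal.ofReal_natCast, ← Nat.cast_sum]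
  congr 1
  rw [← ENNReal.ofReal_natCast]
  push_cast
  rfl

/-- Every joint strategy of finite cost creates at least `n - 1` edges. -/
theorem ofReal_le_totalCost [Nonempty V] (α : ℝ≥0) (t : JointStrategy G) :
    ENNReal.ofReal (α * (Fintype.card V - 1)) ≤ totalCost α t := by
  classical
  by_cases h : (t.graph α).Connected
  · rw [totalCost_eq_ofReal h]
    refine ENNReal.ofReal_le_ofReal ?_
    have h1 := h.card_vert_le_card_edgeSet_add_one
    rw [Nat.card_eq_fintype_card, Nat.card_eq_fintype_card, ← SimpleGraph.edgeFinset_card] at h1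
    have h2 : (Fintype.card V : ℝ) - 1 ≤ (t.graph α).edgeFinset.card := by
      rw [sub_le_iff_le_add]; exact_mod_cast h1
    have h3 : 0 ≤ ∑ i, ∑ j, ((t.graph α).dist i j : ℝ) := by positivity
    have := mul_le_mul_of_nonneg_left h2 α.coe_nonneg
    linarith
  · have h1 : ¬ (t.graph α).Preconnected := fun hp => h ⟨hp⟩
    unfold SimpleGraph.Preconnected at h1
    push Not at h1
    obtain ⟨i, j, hij⟩ := h1
    have h2 : ((t.graph α).edist i j : ℝ≥0∞) = ⊤ := by
      rw [SimpleGraph.edist_eq_top_of_not_reachable hij]; rfl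
    have h3 : ∑ i, ∑ j, ((t.graph α).edist i j : ℝ≥0∞) = ⊤ :=
      ENNReal.sum_eq_top.2 ⟨i, Finset.mem_univ _, ENNReal.sum_eq_top.2 ⟨j, Finset.mem_univ _, h2⟩⟩
    rw [totalCost, h3, add_top]
    exact le_top

theorem IsCollaborativeEquilibrium.dist_le {s : JointStrategy (⊤ : SimpleGraph V)}
    (hs : s.IsCollaborativeEquilibrium α) (hα : (Fintype.card V : ℝ≥0) < α) (u v : V) :
    ((s.graph α).dist u v : ℝ) ≤
      116 * (Real.logb 2 (Fintype.card V) ^ Real.logb 2 6 * √((α : ℝ) / Fintype.card V)) := by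
  by_cases hn : 2 ≤ Fintype.card V
  · exact hs.shortcutBound.dist_le hs.1 hn (by exact_mod_cast hα) u v
  · have : Subsingleton V := Fintype.card_le_one_iff_subsingleton.1 (by omega)
    rw [Subsingleton.elim u v, SimpleGraph.dist_self, Nat.cast_zero]
    have : 0 ≤ Real.logb 2 (Fintype.card V) := by
      rcases Nat.eq_zero_or_pos (Fintype.card V) with h | h
      -- For the empty vertex set, `Real.logb 2 0 = 0`.
      · simp [h]
      · exact Real.logb_nonneg (by norm_num) (by exact_mod_cast h)
    positivity

/-- The edge count bounds the cost by `2αn + 4 lg n · ∑ d(i, j)`, and the diameter bound applies to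
each of the `n²` distances. The identity `n √(α/n) = α √(n/α)` brings out the factor `αn`. The
constant is `4 · 116 · 2`, the last factor coming from `n ≤ 2 (n - 1)`. -/
theorem IsCollaborativeEquilibrium.cost_le {s : JointStrategy (⊤ : SimpleGraph V)}
    (hs : s.IsCollaborativeEquilibrium α) (hα : (Fintype.card V : ℝ≥0) < α)
    (hn : 2 ≤ Fintype.card V) [Fintype (s.graph α).edgeSet] :
    α * (s.graph α).edgeFinset.card + ∑ i, ∑ j, ((s.graph α).dist i j : ℝ) ≤
      928 * (1 + √((Fintype.card V : ℝ) / α) *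
        Real.logb 2 (Fintype.card V) ^ (1 + Real.logb 2 6)) * (α * (Fintype.card V - 1)) := by
  have hE := hs.deletionBound.mul_card_edgeFinset_le hs.1 α.coe_nonneg
  have hD : ∑ i, ∑ j, ((s.graph α).dist i j : ℝ) ≤ _ :=
    Finset.sum_le_sum fun i _ => Finset.sum_le_sum fun j _ => hs.dist_le hα i j
  simp only [Finset.sum_const, Finset.card_univ, nsmul_eq_mul] at hD
  have hα' : ((Fintype.card V : ℕ) : ℝ) < α := by exact_mod_cast hα
  have hlog : (Nat.log 2 (Fintype.card V) : ℝ) ≤ Real.logb 2 (Fintype.card V) := by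
    exact_mod_cast Real.natLog_le_logb (Fintype.card V) 2
  have hD0 : 0 ≤ ∑ i, ∑ j, ((s.graph α).dist i j : ℝ) := by positivity
  generalize ∑ i, ∑ j, ((s.graph α).dist i j : ℝ) = D at *
  generalize ((s.graph α).edgeFinset.card : ℝ) = E at *
  have hn' : (2 : ℝ) ≤ Fintype.card V := by exact_mod_cast hn
  push_cast at hE
  generalize (Nat.log 2 (Fintype.card V) : ℝ) = m at *
  generalize (Fintype.card V : ℝ) = n at *
  generalize (α : ℝ) = a at *
  have hl1 : 1 ≤ Real.logb 2 n := by
    rw [Real.le_logb_iff_rpow_le (by norm_num) (by linarith)]; simpa using hn'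
  rw [Real.rpow_add (by linarith), Real.rpow_one]
  set l := Real.logb 2 n
  set b := l ^ Real.logb 2 6
  have hb0 : 0 ≤ b := by positivity
  have hsqrt : n * √(a / n) = a * √(n / a) := by
    rw [Real.sqrt_div (by linarith), Real.sqrt_div (by linarith)]
    have h1 : √n * √n = n := Real.mul_self_sqrt (by linarith)
    have h2 : √a * √a = a := Real.mul_self_sqrt (by linarith)
    have h3 : 0 < √n := Real.sqrt_pos.2 (by linarith)
    have h4 : 0 < √a := Real.sqrt_pos.2 (by linarith)
    rw [mul_div_assoc', mul_div_assoc', div_eq_div_iff h3.ne' h4.ne']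
    calc n * √a * √a = n * (√a * √a) := by ring
      _ = a * (√n * √n) := by rw [h1, h2]; ring
      _ = _ := by ring
  have hD' : D ≤ 116 * (n * a) * (b * √(n / a)) := by
    calc D ≤ _ := hD
      _ = 116 * n * b * (n * √(a / n)) := by ring
      _ = _ := by rw [hsqrt]; ring
  have h5 : (2 * m + 1) * D ≤ 3 * l * D := by gcongr; linarith
  have h6 : D ≤ l * D := le_mul_of_one_le_left hD0 hl1
  have h7 : l * D ≤ l * (116 * (n * a) * (b * √(n / a))) := by gcongr
  have h8 : n * a ≤ 2 * (a * (n - 1)) := by nlinarith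
  set q := √(n / a) * (l * b) with hq
  have hq0 : 0 ≤ q := by positivity
  calc a * E + D ≤ 2 * a * n + 4 * (l * D) := by linarith
    _ ≤ 2 * a * n + 4 * (l * (116 * (n * a) * (b * √(n / a)))) := by linarith
    _ = (2 + 464 * q) * (n * a) := by rw [hq]; ring
    _ ≤ (464 + 464 * q) * (2 * (a * (n - 1))) := by
        gcongr
        · nlinarith
        · norm_num
    _ = _ := by ring

theorem totalCost_eq_zero_of_subsingleton [Subsingleton V] (α : ℝ≥0) (s : JointStrategy G) :
    totalCost α s = 0 := by
  have : IsEmpty G.edgeSet := ⟨fun e => by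
    obtain ⟨e, he⟩ := e
    induction e with
    | _ x y => exact he.ne (Subsingleton.elim x y)⟩
  have h1 : ∀ i j : V, (s.graph α).edist i j = 0 := fun i j => by
    rw [Subsingleton.elim i j, SimpleGraph.edist_self]
  simp [totalCost, h1, Set.eq_empty_of_isEmpty]

end JointStrategy

open JointStrategy in
theorem priceOfAnarchy_top_le {V : Type*} [Fintype V] {α : ℝ≥0}
    (hα : (Fintype.card V : ℝ≥0) < α) :
    priceOfAnarchy (⊤ : SimpleGraph V) α ≤ ENNReal.ofReal (928 * (1 + √((Fintype.card V : ℝ) / α) *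
      Real.logb 2 (Fintype.card V) ^ (1 + Real.logb 2 6))) := by
  classical
  unfold priceOfAnarchy
  by_cases hn : 2 ≤ Fintype.card V
  · have : Nonempty V := Fintype.card_pos_iff.1 (by omega)
    refine ENNReal.div_le_of_le_mul (iSup₂_le fun s hs => ?_)
    have hn' : (2 : ℝ) ≤ Fintype.card V := by exact_mod_cast hn
    have hl : 0 ≤ Real.logb 2 (Fintype.card V) := Real.logb_nonneg (by norm_num) (by linarith)
    rw [totalCost_eq_ofReal hs.1]
    refine (ENNReal.ofReal_le_ofReal (hs.cost_le hα hn)).trans ?_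
    rw [ENNReal.ofReal_mul (by positivity)]
    gcongr
    exact le_iInf fun t => ofReal_le_totalCost α t
  -- With at most one player all costs vanish, and `0 / 0 = 0` in `ℝ≥0∞`.
  · have : Subsingleton V := Fintype.card_le_one_iff_subsingleton.1 (by omega)
    simp [totalCost_eq_zero_of_subsingleton]

theorem mainTheorem2 :
    ∃ K : ℝ, 0 < K ∧ ∀ (n : ℕ) (α : ℝ≥0), (n : ℝ≥0) < α →
      priceOfAnarchy (⊤ : SimpleGraph (Fin n)) α ≤
          ENNReal.ofReal
            (K * (1 + √((n : ℝ) / α) * Real.logb 2 n ^ (1 + Real.logb 2 6))) ∧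
        ∀ s : JointStrategy (⊤ : SimpleGraph (Fin n)), s.IsCollaborativeEquilibrium α →
          ((s.graph α).ediam : ℝ≥0∞) ≤
            ENNReal.ofReal (K * (Real.logb 2 n ^ Real.logb 2 6 * √((α : ℝ) / n))) := by
  refine ⟨928, by norm_num, fun n α hα => ?_⟩
  have hα' : (Fintype.card (Fin n) : ℝ≥0) < α := by simpa using hα
  refine ⟨by simpa using priceOfAnarchy_top_le hα', fun s hs => ?_⟩
  refine SimpleGraph.ediam_le_ofReal hs.1 fun u v => ?_
  have h := hs.dist_le hα' u v
  rw [Fintype.card_fin] at h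
  have h0 : (0 : ℝ) ≤ (s.graph α).dist u v := Nat.cast_nonneg _
  linarith
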